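/- **Setting.** Let $0\le q\le r\le m$ be integers. Index $n=2^m$ qubits by the vertices $x\in\mathbb Z_2^m$ of the $m$-dimensional hypercube. For $J\subseteq\{1,\dots,m\}$ let $\langle J\rangle\subseteq\mathbb Z_2^m$ be the subgroup of bit strings supported in $J$; a $d$-cube (subcube of dimension $d$) is a coset $A=x+\langle J\rangle$ with $|J|=d=\dim A$. For a single-qubit operator $U$, let $U_A$ act as $U$ on the qubits in $A$ and as the identity elsewhere. The quantum Reed--Muller code $QRM_m(q,r)$ is the common $+1$ eigenspace of the group generated by the Pauli operators $X_A$ for all $(m-q)$-cubes $A$ and $Z_A$ for all $(r+1)$-cubes $A$. For an integer $k\ge 0$ let $Z(k)=|0\rangle\langle 0|+e^{i\pi/2^k}|1\rangle\langle 1|$. The unsigned operator $Z(k)_A$ acts as $Z(k)$ on the qubits in $A$ and as the identity elsewhere. The signed operator $\widetilde Z(k)_A$ acts as $Z(k)$ on the qubits $x\in A$ of even Hamming weight, as $Z(k)^\dagger$ on the qubits $x\in A$ of odd Hamming weight, and as the identity elsewhere. The Clifford hierarchy is given by $\mathrm{Cl}^{(0)}=\mathcal P_n$, the $n$-qubit Pauli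 group (with phases $\pm1,\pm i$), and $\mathrm{Cl}^{(k)}=\{U \text{ unitary} : U\mathcal P_nU^\dagger\subseteq \mathrm{Cl}^{(k-1)}\}$ for $k\ge1$. For a code $\mathcal C$, the level-$k$ Clifford stabilizers (logical identities) are $\mathcal S^{(k)}=\{U\in \mathrm{Cl}^{(k)} : U|\psi\rangle=|\psi\rangle\ \forall|\psi\rangle\in\mathcal C\}$; the level-$k$ undetectable Clifford errors are $\mathcal N^{(k)}=\{U\in\mathrm{Cl}^{(k)} : U\mathcal S^{(0)}U^\dagger\subseteq\mathcal S^{(k-1)}\}$, where $\mathcal S^{(-1)}:=\mathcal S^{(0)}$; the non-trivial level-$k$ logical operators are $\mathcal E^{(k)}=\mathcal N^{(k)}\setminus\mathcal S^{(k)}$. An operator $U$ preserves $\mathcal C$ if $U|\psi\rangle\in\mathcal C$ for all $|\psi\rangle\in\mathcal C$. **Theorem.** Let $0\le q\le r\le m$ and $k\ge0$ be integers, and let $A$ be a subcube of the $m$-dimensional hypercube. For the code $\mathcal C=QRM_m(q,r)$: 1. $\widetilde Z(k)_A\in\mathcal S^{(k)}$ if and only if $\dim A\ge (k+1)r+1$.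 2. $\widetilde Z(k)_A\in\mathcal E^{(k)}$ if and only if $q+kr+1\le\dim A\le (k+1)r$. 3. $\widetilde Z(k)_A$ preserves the code space if and only if $\dim A\ge q+kr+1$; in particular, for $\dim A\le q+kr$ the code space is not preserved. If moreover $r\ge1$ (which is automatic when $q<r$), then the same holds for the unsigned operator: 4. $Z(k)_A\in\mathcal S^{(k)}$ if and only if $\dim A\ge (k+1)r+1$. 5. $Z(k)_A\in\mathcal E^{(k)}$ if and only if $q+kr+1\le\dim A\le (k+1)r$. 6. $Z(k)_A$ preserves the code space if and only if $\dim A\ge q+kr+1$; in particular, for $\dim A\le q+kr$ the code space is not preserved. -/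

import Mathlib

open scoped Matrix

noncomputable section

namespace QuantumRM

/-! ### Operators on finitely many qubits

Qubits are indexed by a finite type `ι`; computational basis states are labelled by bit
assignments `ι → Fin 2`, a state is a vector of amplitudes, and an operator is a matrix. -/

section Qubits

variable (ι : Type) [Fintype ι] [DecidableEq ι]

/-- Vectors of `(ℂ²)^{⊗ ι}`, written in the computational basis. -/
abbrev State : Type := (ι → Fin 2) → ℂ

/-- Linear operators on `(ℂ²)^{⊗ ι}`, written in the computational basis. -/
abbrev Operator : Type := Matrix (ι → Fin 2) (ι → Fin 2) ℂ

variable {ι}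

/-- The tensor product `⨂ x, U x` of single-qubit operators. -/
def tensorOp (U : ι → Matrix (Fin 2) (Fin 2) ℂ) : Operator ι :=
  Matrix.of fun b c => ∏ x, U x (b x) (c x)

open Classical in
/-- The transversal operator `U_A`: it acts as `U` on the qubits in `A` and as the identity
elsewhere. -/
def transversal (U : Matrix (Fin 2) (Fin 2) ℂ) (A : Set ι) : Operator ι :=
  tensorOp fun x => if x ∈ A then U else 1

/-- The Pauli matrix `X`. -/
def pauliX : Matrix (Fin 2) (Fin 2) ℂ := !![0, 1; 1, 0]

/-- The Pauli matrix `Y`. -/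
def pauliY : Matrix (Fin 2) (Fin 2) ℂ := !![0, -Complex.I; Complex.I, 0]

/-- The Pauli matrix `Z`. -/
def pauliZ : Matrix (Fin 2) (Fin 2) ℂ := !![1, 0; 0, -1]

/-- The single-qubit Pauli group `{±P, ±iP : P = 1, X, Y, Z}`. -/
def singlePauliGroup : Set (Matrix (Fin 2) (Fin 2) ℂ) :=
  {M | ∃ c ∈ ({1, -1, Complex.I, -Complex.I} : Set ℂ),
    ∃ P ∈ ({1, pauliX, pauliY, pauliZ} : Set (Matrix (Fin 2) (Fin 2) ℂ)), M = c • P}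

variable (ι) in
/-- The Pauli group on the qubits `ι`: tensor products of single-qubit Pauli operators. -/
def pauliGroup : Set (Operator ι) :=
  {M | ∃ P : ι → Matrix (Fin 2) (Fin 2) ℂ, (∀ x, P x ∈ singlePauliGroup) ∧ M = tensorOp P}

variable (ι) in
/-- The levels of the Clifford hierarchy, level `0` being the Pauli group. -/
def cliffordHierarchy : ℕ → Set (Operator ι)
  | 0 => pauliGroup ι
  | k + 1 => {U | U ∈ Matrix.unitaryGroup (ι → Fin 2) ℂ ∧
      ∀ P ∈ pauliGroup ι, U * P * Uᴴ ∈ cliffordHierarchy k}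

/-- The common `+1` eigenspace of a set of operators. -/
def commonFixedSpace (S : Set (Operator ι)) : Submodule ℂ (State ι) where
  carrier := {ψ | ∀ U ∈ S, U *ᵥ ψ = ψ}
  zero_mem' := fun _ _ => Matrix.mulVec_zero _
  add_mem' := fun ha hb U hU => by rw [Matrix.mulVec_add, ha U hU, hb U hU]
  smul_mem' := fun c _ ha U hU => by rw [Matrix.mulVec_smul, ha U hU]

/-- Level-`k` Clifford stabilizers of a code: operators in the `k`-th level of the Clifford
hierarchy that act on the code as the logical identity. -/
def cliffordStabilizers (C : Submodule ℂ (State ι)) (k : ℕ) : Set (Operator ι) :=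
  {U | U ∈ cliffordHierarchy ι k ∧ ∀ ψ ∈ C, U *ᵥ ψ = ψ}

/-- Level-`k` undetectable Clifford errors of a code: operators in the `k`-th level of the
Clifford hierarchy that conjugate Pauli stabilizers to level-`(k - 1)` Clifford stabilizers.
The truncated subtraction `0 - 1 = 0` is the convention that level `-1` means level `0`. -/
def undetectableErrors (C : Submodule ℂ (State ι)) (k : ℕ) : Set (Operator ι) :=
  {U | U ∈ cliffordHierarchy ι k ∧
    ∀ S ∈ cliffordStabilizers C 0, U * S * Uᴴ ∈ cliffordStabilizers C (k - 1)}

/-- Level-`k` non-trivial Clifford logical operators of a code. -/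
def cliffordLogicals (C : Submodule ℂ (State ι)) (k : ℕ) : Set (Operator ι) :=
  undetectableErrors C k \ cliffordStabilizers C k

/-- An operator preserves the code space if it maps code states to code states. -/
def PreservesCode (C : Submodule ℂ (State ι)) (U : Operator ι) : Prop :=
  ∀ ψ ∈ C, U *ᵥ ψ ∈ C

end Qubits

/-! ### The hypercube and its subcubes -/

/-- The vertices of the `m`-dimensional hypercube. -/
abbrev Cube (m : ℕ) : Type := Fin m → ZMod 2

/-- The standard subcube `⟨J⟩`: the subgroup of bit strings supported in `J`. -/
def standardSubcube {m : ℕ} (J : Finset (Fin m)) : AddSubgroup (Cube m) where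
  carrier := {y | ∀ i, i ∉ J → y i = 0}
  zero_mem' := fun _ _ => rfl
  add_mem' := fun ha hb i hi => by simp [ha i hi, hb i hi]
  neg_mem' := fun ha i hi => by simp [ha i hi]

/-- `A` is a `d`-cube: a coset `x + ⟨J⟩` of a standard subcube with `|J| = d`. -/
def IsSubcube {m : ℕ} (d : ℕ) (A : Set (Cube m)) : Prop :=
  ∃ (x : Cube m) (J : Finset (Fin m)),
    J.card = d ∧ A = (fun y => x + y) '' (standardSubcube J : Set (Cube m))

/-! ### Quantum Reed--Muller codes and subcube operators -/

/-- The `X` stabilizer generators: `X_A` for all `(m - q)`-cubes `A`. -/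
def stabilizerGeneratorsX (m q : ℕ) : Set (Operator (Cube m)) :=
  {U | ∃ A : Set (Cube m), IsSubcube (m - q) A ∧ U = transversal pauliX A}

/-- The `Z` stabilizer generators: `Z_A` for all `(r + 1)`-cubes `A`. -/
def stabilizerGeneratorsZ (m r : ℕ) : Set (Operator (Cube m)) :=
  {U | ∃ A : Set (Cube m), IsSubcube (r + 1) A ∧ U = transversal pauliZ A}

/-- The stabilizer group generated by the `X` and `Z` generators. As every generator is an
involution, the monoid that they generate is the group that they generate. -/
def stabilizerGroup (m q r : ℕ) : Submonoid (Operator (Cube m)) :=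
  Submonoid.closure (stabilizerGeneratorsX m q ∪ stabilizerGeneratorsZ m r)

/-- The quantum Reed--Muller code `QRM_m(q, r)` on `2 ^ m` qubits (for `q ≤ r ≤ m`). -/
def code (m q r : ℕ) : Submodule ℂ (State (Cube m)) :=
  commonFixedSpace (stabilizerGroup m q r : Set (Operator (Cube m)))

/-- The single-qubit gate `Z(k) = |0⟩⟨0| + e^{iπ/2^k} |1⟩⟨1|`. -/
def zGate (k : ℕ) : Matrix (Fin 2) (Fin 2) ℂ :=
  !![1, 0; 0, Complex.exp (Complex.I * (Real.pi / 2 ^ k))]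

/-- The unsigned operator `Z(k)_A`. -/
def unsignedZ {m : ℕ} (k : ℕ) (A : Set (Cube m)) : Operator (Cube m) :=
  transversal (zGate k) A

open Classical in
/-- The signed operator `Z̃(k)_A`: on the qubits `x ∈ A` it acts as `Z(k)` if the Hamming weight
of `x` is even and as the adjoint of `Z(k)` if it is odd. -/
def signedZ {m : ℕ} (k : ℕ) (A : Set (Cube m)) : Operator (Cube m) :=
  tensorOp fun x =>
    if x ∈ A then (if Even (hammingNorm x) then zGate k else (zGate k)ᴴ) else 1

end QuantumRM

end

/-!
The operators `signedZ k A` and `unsignedZ k A` are tensor products of powers of `Z(k)`. On the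
basis state labelled by a Boolean function `f` on the cube they act as the phase
`e^{iπ S(f)/2^k}`, where `S(f) = bitWeight w f` is the sum of the lifted bits of `f`, with weights
`w x = (-1)^|x|` or `1` on `A`. Code states of `QRM_m(q, r)` are exactly the vectors that are
supported on the classical Reed–Muller code `reedMuller m r` and invariant under translation by
indicator functions of faces of codimension `q` (`mem_code_iff`, by the duality
`mem_reedMuller_iff`). Hence the operator fixes the code pointwise if and only if `2^(k+1)` divides
`S(f)` for all `f` in `reedMuller m r`, and it preserves the code if and only if `2^(k+1)` divides
`S(f + 1_B) - S(f)` for all such `f` and all faces `B` of codimension `q`.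

For the signed weights this difference is the signed character sum
`E_F(f) = ∑ x ∈ F, (-1)^|x| (-1)^(f x)` over `F = A ∩ B`. If `dim F ≥ N r + 1`, then `2^(N+1)`
divides `E_F(f)` for all `f` in `reedMuller m r` (`dvd_signedSum`), and if `dim F ≤ N r`, then it
does not for some `f` (`exists_not_dvd_signedSum`). Both follow by induction from the recursion
`E_F(f + 1_B) = E_F(f) - 2 E_{F ∩ B}(f)`, as intersecting with a face of codimension `r` lowers
the dimension by at most `r`. This gives the bound `dim A ≥ q + k r + 1` for preservation; the
bound `dim A ≥ (k + 1) r + 1` for stabilizers is the case `q = r`, because `S(0) = 0` and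
`reedMuller m r` is spanned by indicator functions. If `r ≥ 1`, then the parity `∑ i, x i` belongs
to `reedMuller m r`, and translating by it turns the unsigned into the signed weights
(`bitWeight_unsigned`).

Membership in the Clifford hierarchy always holds: conjugating a Pauli matrix by a diagonal or
antidiagonal gate squares the ratio of the entries of the gate, which lowers the level by one
(`conj_mem_monomialGates`). For a code that is stabilized by Pauli operators, such a gate is an
undetectable error if and only if it preserves the code (`tensorOp_mem_undetectableErrors_iff`), so
the non-trivial logical operators are those that preserve the code without fixing it pointwise.
-/

namespace QuantumRM

/-! ### Subcubes as faces -/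

section Faces

variable {m : ℕ}

/-- The subcube of all vertices that agree with `a` on the coordinates in `K`; its codimension
is `K.card`. -/
def face (a : Cube m) (K : Finset (Fin m)) : Finset (Cube m) :=
  Finset.univ.filter fun x => ∀ i ∈ K, x i = a i

@[simp]
lemma mem_face {a x : Cube m} {K : Finset (Fin m)} : x ∈ face a K ↔ ∀ i ∈ K, x i = a i := by
  simp [face]

lemma isSubcube_iff {d : ℕ} {A : Set (Cube m)} :
    IsSubcube d A ↔ ∃ (a : Cube m) (K : Finset (Fin m)), K.card + d = m ∧ A = face a K := by
  have key : ∀ (x : Cube m) (J : Finset (Fin m)),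
      (fun y => x + y) '' (standardSubcube J : Set (Cube m)) = face x Jᶜ := by
    intro x J
    ext y
    simp only [Set.mem_image, SetLike.mem_coe, mem_face, Finset.mem_compl]
    constructor
    · rintro ⟨z, hz, rfl⟩ i hi
      simp [hz i hi]
    · intro h
      exact ⟨y - x, fun i hi => by simp [h i hi], by simp⟩
  constructor
  · rintro ⟨x, J, rfl, rfl⟩
    refine ⟨x, Jᶜ, ?_, key x J⟩
    simp
  · rintro ⟨a, K, h, rfl⟩
    refine ⟨a, Kᶜ, ?_, by rw [key, compl_compl]⟩
    rw [Finset.card_compl, Fintype.card_fin]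
    omega

lemma face_eq_of_mem {a c : Cube m} {K : Finset (Fin m)} (h : c ∈ face a K) :
    face a K = face c K := by
  ext x
  rw [mem_face] at h
  simp only [mem_face]
  exact forall₂_congr fun i hi => by rw [h i hi]

lemma face_inter_self (a : Cube m) (K L : Finset (Fin m)) :
    face a K ∩ face a L = face a (K ∪ L) := by
  ext x
  simp [or_imp, forall_and]

lemma face_inter (a b : Cube m) (K L : Finset (Fin m)) :
    face a K ∩ face b L = ∅ ∨ ∃ c, face a K ∩ face b L = face c (K ∪ L) := by
  rcases (face a K ∩ face b L).eq_empty_or_nonempty with h | ⟨c, hc⟩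
  · exact .inl h
  · rw [Finset.mem_inter] at hc
    exact .inr ⟨c, by rw [face_eq_of_mem hc.1, face_eq_of_mem hc.2, face_inter_self]⟩

lemma sum_face_add_single {M : Type*} [AddCommMonoid M] (a : Cube m) {K : Finset (Fin m)}
    {i : Fin m} (hi : i ∉ K) (g : Cube m → M) :
    ∑ x ∈ face a K, g (x + Pi.single i 1) = ∑ x ∈ face a K, g x := by
  refine Finset.sum_equiv (Equiv.addRight (Pi.single i 1)) (fun x => ?_) fun x _ => rfl
  simp only [mem_face, Equiv.coe_addRight, Pi.add_apply]
  refine forall₂_congr fun j hj => ?_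
  rw [Pi.single_eq_of_ne (fun h : j = i => hi (h ▸ hj)), add_zero]

lemma sum_face_split {M : Type*} [AddCommMonoid M] (a : Cube m) {K : Finset (Fin m)}
    {i : Fin m} (hi : i ∉ K) (g : Cube m → M) :
    ∑ x ∈ face a K, g x =
      ∑ x ∈ face a (insert i K), g x + ∑ x ∈ face (a + Pi.single i 1) (insert i K), g x := by
  rw [← Finset.sum_filter_add_sum_filter_not (face a K) (fun x => x i = a i)]
  have two : ∀ c e : ZMod 2, ¬ c = e ↔ c = e + 1 := by decide
  congr 2
  · ext x
    simp [and_comm]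
  · ext x
    simp only [Finset.mem_filter, mem_face, two, Finset.forall_mem_insert, Pi.add_apply,
      Pi.single_eq_same]
    rw [and_comm]
    refine and_congr_right fun _ => forall₂_congr fun j hj => ?_
    rw [Pi.single_eq_of_ne (fun h : j = i => hi (h ▸ hj)), add_zero]

/-- A face of codimension `K.card` can be cut by a face of any codimension `c ≤ m` through the
same vertex so that as many new coordinates as possible become fixed. -/
lemma exists_card_union (K : Finset (Fin m)) {c : ℕ} (hc : c ≤ m) :
    ∃ L : Finset (Fin m), L.card = c ∧ min m (K.card + c) ≤ (K ∪ L).card := by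
  have hK : Kᶜ.card = m - K.card := by rw [Finset.card_compl, Fintype.card_fin]
  have hKm : K.card ≤ m := by simpa using K.card_le_univ
  rcases le_total c Kᶜ.card with h | h
  · obtain ⟨L, hL, hcard⟩ := Finset.exists_subset_card_eq h
    refine ⟨L, hcard, ?_⟩
    have hdis : Disjoint K L :=
      Finset.disjoint_left.2 fun i hi hi' => Finset.mem_compl.1 (hL hi') hi
    rw [Finset.card_union_of_disjoint hdis, hcard]
    exact min_le_right _ _
  · obtain ⟨L, hL, -, hcard⟩ := Finset.exists_subsuperset_card_eq
      (Finset.subset_univ Kᶜ) h (by simpa using hc)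
    refine ⟨L, hcard, (min_le_left _ _).trans ?_⟩
    have : K ∪ L = Finset.univ := by
      rw [Finset.eq_univ_iff_forall]
      intro i
      by_cases hi : i ∈ K
      · exact Finset.mem_union_left _ hi
      · exact Finset.mem_union_right _ (hL (Finset.mem_compl.2 hi))
    simp [this]

end Faces

/-! ### Signed character sums over faces -/

section SignedSums

variable {m : ℕ}

/-- The nontrivial character `c ↦ (-1) ^ c` of `ZMod 2`, with integer values. -/
def bitSign (c : ZMod 2) : ℤ := if c = 0 then 1 else -1

@[simp] lemma bitSign_zero : bitSign 0 = 1 := rfl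

lemma bitSign_add : ∀ c e : ZMod 2, bitSign (c + e) = bitSign c * bitSign e := by decide

lemma bitSign_one : bitSign 1 = -1 := rfl

lemma bitSign_eq_or (c : ZMod 2) : bitSign c = 1 ∨ bitSign c = -1 := by
  unfold bitSign; split_ifs <;> simp

lemma val_add_bit : ∀ c e : ZMod 2,
    ((c + e).val : ℤ) = c.val + e.val * bitSign c := by decide

/-- The parity `∑ i, x i` of the Hamming weight, as a Boolean function on the cube. -/
def parity (x : Cube m) : ZMod 2 := ∑ i, x i

lemma parity_add_single (x : Cube m) (i : Fin m) :
    parity (x + Pi.single i 1) = parity x + 1 := by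
  simp [parity, Finset.sum_add_distrib]

lemma even_hammingNorm_iff (x : Cube m) : Even (hammingNorm x) ↔ parity x = 0 := by
  have two : ∀ c : ZMod 2, c = if c ≠ 0 then 1 else 0 := by decide
  have h : parity x = (hammingNorm x : ZMod 2) := by
    rw [parity, Finset.sum_congr rfl fun i _ => two (x i), Finset.sum_boole, hammingNorm]
  rw [h, ZMod.natCast_eq_zero_iff_even]

/-- The indicator function of a set of vertices. -/
def bitIndicator (B : Finset (Cube m)) : Cube m → ZMod 2 := fun x => if x ∈ B then 1 else 0

/-- The signed character sum `∑ x ∈ F, (-1) ^ |x| * (-1) ^ f x`. -/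
def signedSum (F : Finset (Cube m)) (f : Cube m → ZMod 2) : ℤ :=
  ∑ x ∈ F, bitSign (parity x) * bitSign (f x)

@[simp] lemma signedSum_empty (f : Cube m → ZMod 2) : signedSum ∅ f = 0 := rfl

/-- Adding the indicator of `B` changes a signed sum by a signed sum over a smaller set, with an
additional factor `2`; the divisibility of signed sums is read off from this recursion. -/
lemma signedSum_add_bitIndicator (F B : Finset (Cube m)) (f : Cube m → ZMod 2) :
    signedSum F (f + bitIndicator B) = signedSum F f - 2 * signedSum (F ∩ B) f := by
  simp only [signedSum, ← Finset.filter_mem_eq_inter, Finset.sum_filter, Finset.mul_sum,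
    ← Finset.sum_sub_distrib]
  refine Finset.sum_congr rfl fun x _ => ?_
  rw [Pi.add_apply, bitSign_add, bitIndicator]
  split_ifs
  · rw [bitSign_one]; ring
  · rw [bitSign_zero]; ring

/-- A face of positive dimension has as many vertices of even as of odd weight. -/
lemma signedSum_face_zero (a : Cube m) {K : Finset (Fin m)} (hK : K.card < m) :
    signedSum (face a K) 0 = 0 := by
  obtain ⟨i, hi⟩ : ∃ i, i ∉ K := by
    by_contra! h
    rw [Finset.eq_univ_of_forall h] at hK
    simp at hK
  have h := sum_face_add_single a hi fun x => bitSign (parity x)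
  simp only [parity_add_single, bitSign_add, bitSign_one, ← Finset.sum_mul] at h
  simp only [signedSum, Pi.zero_apply, bitSign_zero, mul_one]
  linarith

lemma sum_face_one (a : Cube m) {K : Finset (Fin m)} (hK : K.card < m) :
    ∑ _x ∈ face a K, (1 : ZMod 2) = 0 := by
  have h := congrArg (Int.cast : ℤ → ZMod 2) (signedSum_face_zero a hK)
  have one : ∀ c : ZMod 2, ((bitSign c : ℤ) : ZMod 2) = 1 := by decide
  simpa [signedSum, one] using h

end SignedSums

/-! ### Reed–Muller codes -/

section ReedMuller

variable {m : ℕ}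

/-- The classical Reed–Muller code of order `r`, as the span of the indicator functions of faces
of codimension at most `r`. -/
def reedMuller (m r : ℕ) : AddSubgroup (Cube m → ZMod 2) :=
  AddSubgroup.closure
    {f | ∃ (a : Cube m) (L : Finset (Fin m)), L.card ≤ r ∧ f = bitIndicator (face a L)}

lemma bitIndicator_mem_reedMuller (a : Cube m) {L : Finset (Fin m)} {r : ℕ} (hL : L.card ≤ r) :
    bitIndicator (face a L) ∈ reedMuller m r :=
  AddSubgroup.subset_closure ⟨a, L, hL, rfl⟩

lemma reedMuller_mono {q r : ℕ} (h : q ≤ r) : reedMuller m q ≤ reedMuller m r :=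
  AddSubgroup.closure_mono fun _ ⟨a, L, hL, hf⟩ => ⟨a, L, hL.trans h, hf⟩

/-- Induction on the number of indicator functions of faces in a sum. -/
lemma reedMuller_induction {r : ℕ} {p : ∀ f : Cube m → ZMod 2, f ∈ reedMuller m r → Prop}
    (zero : p 0 (zero_mem _))
    (add : ∀ f (a : Cube m) (L : Finset (Fin m)) (hf : f ∈ reedMuller m r) (hL : L.card ≤ r),
      p f hf → p (f + bitIndicator (face a L)) (add_mem hf (bitIndicator_mem_reedMuller a hL)))
    {f : Cube m → ZMod 2} (hf : f ∈ reedMuller m r) : p f hf := by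
  refine AddSubgroup.closure_induction_right (p := p) zero ?_ ?_ hf
  · rintro g hg _ ⟨a, L, hL, rfl⟩ h
    exact add g a L hg hL h
  · rintro g hg _ ⟨a, L, hL, rfl⟩ h
    simp only [ZModModule.neg_eq_self]
    exact add g a L hg hL h

lemma parity_mem_reedMuller {r : ℕ} (hr : 0 < r) : (parity : Cube m → ZMod 2) ∈ reedMuller m r := by
  have two : ∀ c : ZMod 2, c = if c = 1 then 1 else 0 := by decide
  have h : (parity : Cube m → ZMod 2) = ∑ i, bitIndicator (face 1 {i}) := by
    ext x
    rw [Finset.sum_apply, parity]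
    refine Finset.sum_congr rfl fun i _ => ?_
    simpa [bitIndicator] using two (x i)
  rw [h]
  exact sum_mem fun i _ => bitIndicator_mem_reedMuller _ ((Finset.card_singleton i).trans_le hr)

lemma sum_bitIndicator_face (a b : Cube m) {K L : Finset (Fin m)} (h : K.card + L.card < m) :
    ∑ x ∈ face a K, bitIndicator (face b L) x = 0 := by
  simp only [bitIndicator, ← Finset.sum_filter, Finset.filter_mem_eq_inter]
  rcases face_inter a b K L with h' | ⟨c, hc⟩
  · rw [h', Finset.sum_empty]
  · rw [hc]
    exact sum_face_one c ((Finset.card_union_le K L).trans_lt h)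

lemma sum_face_of_mem_reedMuller {r : ℕ} {f : Cube m → ZMod 2} (hf : f ∈ reedMuller m r)
    (a : Cube m) {K : Finset (Fin m)} (hK : K.card + r < m) : ∑ x ∈ face a K, f x = 0 := by
  induction hf using reedMuller_induction with
  | zero => simp
  | add f b L _ hL ih =>
    simp only [Pi.add_apply, Finset.sum_add_distrib, ih, zero_add]
    exact sum_bitIndicator_face a b (by omega)

/-- The algebraic normal form: the coefficient of the monomial `∏ i ∈ I, x i` is the sum of `f`
over the standard subcube `⟨I⟩`. -/
lemma eq_sum_monomials (f : Cube m → ZMod 2) :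
    f = ∑ I : Finset (Fin m), (∑ y ∈ face 0 Iᶜ, f y) • bitIndicator (face 1 I) := by
  have two : ∀ c e : ZMod 2, (c + (1 + e)) = if c = e then 1 else 0 := by decide
  have one : ∀ c : ZMod 2, c = if c = 1 then 1 else 0 := by decide
  have zero : ∀ c : ZMod 2, 1 + c = if c = 0 then 1 else 0 := by decide
  ext x
  calc f x = ∑ y, f y * ∏ i, (x i + (1 + y i)) := by
        simp only [two, Finset.prod_ite_zero, Finset.prod_const_one, Finset.mem_univ,
          forall_const, ← funext_iff, mul_ite, mul_one, mul_zero, Finset.sum_ite_eq, if_true]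
    _ = ∑ y, ∑ I : Finset (Fin m), f y * ((∏ i ∈ I, x i) * ∏ i ∈ Iᶜ, (1 + y i)) := by
        refine Finset.sum_congr rfl fun y _ => ?_
        rw [Finset.prod_add, Finset.mul_sum, Finset.powerset_univ]
        rfl
    _ = _ := by
        rw [Finset.sum_comm, Finset.sum_apply]
        refine Finset.sum_congr rfl fun I _ => ?_
        have h1 : ∏ i ∈ I, x i = bitIndicator (face 1 I) x := by
          rw [Finset.prod_congr rfl fun i _ => one (x i), Finset.prod_ite_zero]
          simp [bitIndicator]
        have h2 : ∀ y : Cube m, ∏ i ∈ Iᶜ, (1 + y i) = if y ∈ face 0 Iᶜ then 1 else 0 := by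
          intro y
          simp only [zero, Finset.prod_ite_zero, Finset.prod_const_one, mem_face, Pi.zero_apply]
        simp only [h1, h2, Pi.smul_apply, smul_eq_mul, Finset.sum_mul, face, Finset.sum_filter]
        refine Finset.sum_congr rfl fun y _ => ?_
        split_ifs <;> simp

/-- If a function sums to zero over all faces of one dimension, then so it does over all faces
of larger dimension, these being disjoint unions of the former. -/
lemma sum_face_eq_zero_of_le {f : Cube m → ZMod 2} {c : ℕ}
    (h : ∀ (a : Cube m) (K : Finset (Fin m)), K.card = c → ∑ x ∈ face a K, f x = 0)
    (hc : c ≤ m) (a : Cube m) (K : Finset (Fin m)) (hK : K.card ≤ c) :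
    ∑ x ∈ face a K, f x = 0 := by
  obtain ⟨n, hn⟩ := Nat.exists_eq_add_of_le hK
  induction n generalizing a K with
  | zero => exact h a K (by omega)
  | succ n ih =>
    obtain ⟨i, hi⟩ : ∃ i, i ∉ K := by
      by_contra! hall
      have : K.card = m := by rw [Finset.eq_univ_of_forall hall]; simp
      omega
    have hcard := Finset.card_insert_of_notMem hi
    rw [sum_face_split a hi, ih _ _ (by omega) (by omega), ih _ _ (by omega) (by omega), add_zero]

/-- Duality: the Reed–Muller code of order `r` is cut out by the parity checks on faces of
dimension `r + 1`. -/
theorem mem_reedMuller_iff {r : ℕ} {f : Cube m → ZMod 2} :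
    f ∈ reedMuller m r ↔
      ∀ (a : Cube m) (K : Finset (Fin m)), K.card + (r + 1) = m → ∑ x ∈ face a K, f x = 0 := by
  refine ⟨fun hf a K hK => sum_face_of_mem_reedMuller hf a (by omega), fun h => ?_⟩
  rw [eq_sum_monomials f]
  refine sum_mem fun I _ => ?_
  by_cases hI : I.card ≤ r
  · exact ZMod.smul_mem (bitIndicator_mem_reedMuller _ hI) _
  · have hIm : I.card ≤ m := by simpa using I.card_le_univ
    rw [sum_face_eq_zero_of_le (c := m - (r + 1)) (fun a K hK => h a K (by omega)) (by omega),
      zero_smul]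
    · exact zero_mem _
    · rw [Finset.card_compl, Fintype.card_fin]
      omega

/-- A signed version of the Ax–McEliece divisibility theorem. Adding the indicator of a face of
codimension at most `r` changes the sum by twice a sum over a face whose dimension is smaller by
at most `r`. -/
theorem dvd_signedSum {r : ℕ} {f : Cube m → ZMod 2} (hf : f ∈ reedMuller m r) (N : ℕ)
    (a : Cube m) (K : Finset (Fin m)) (hK : K.card + N * r + 1 ≤ m) :
    2 ^ (N + 1) ∣ signedSum (face a K) f := by
  induction hf using reedMuller_induction generalizing N a K with
  | zero => rw [signedSum_face_zero a (by omega)]; exact dvd_zero _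
  | add f b L _ hL ih =>
    rw [signedSum_add_bitIndicator]
    refine dvd_sub (ih N a K hK) ?_
    rw [pow_succ']
    refine mul_dvd_mul_left 2 ?_
    cases N with
    | zero => simp
    | succ N =>
      rcases face_inter a b K L with h | ⟨c, hc⟩
      · rw [h, signedSum_empty]; exact dvd_zero _
      · rw [hc]
        have := Finset.card_union_le K L
        exact ih N c _ (by rw [add_one_mul] at hK; omega)

/-- The divisibility in `dvd_signedSum` is sharp: if all `f` satisfied it, then so would the
signed sums over smaller faces with one factor `2` less, down to a single vertex. -/
theorem exists_not_dvd_signedSum {r : ℕ} (hr : r ≤ m) (N : ℕ) (a : Cube m) (K : Finset (Fin m))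
    (hK : m ≤ K.card + N * r) :
    ∃ f ∈ reedMuller m r, ¬ 2 ^ (N + 1) ∣ signedSum (face a K) f := by
  induction N generalizing K with
  | zero =>
    refine ⟨0, zero_mem _, ?_⟩
    have hKu : K = Finset.univ := Finset.eq_univ_of_card K <| by
      have : K.card ≤ m := by simpa using K.card_le_univ
      rw [Fintype.card_fin]; omega
    have hface : face a K = {a} := by
      ext x
      simp [hKu, funext_iff]
    rw [hface, signedSum, Finset.sum_singleton, Pi.zero_apply, bitSign_zero, mul_one]
    rcases bitSign_eq_or (parity a) with h | h <;> rw [h] <;> decide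
  | succ N ih =>
    obtain ⟨L, hL, hKL⟩ := exists_card_union K hr
    obtain ⟨f, hf, hdvd⟩ := ih (K ∪ L) (by rw [add_one_mul] at hK; omega)
    by_contra! h
    have h1 := h f hf
    have h2 := h _ (add_mem hf (bitIndicator_mem_reedMuller a hL.le))
    rw [signedSum_add_bitIndicator, face_inter_self] at h2
    have h3 := (dvd_sub_right h1).1 h2
    rw [pow_succ'] at h3
    exact hdvd ((mul_dvd_mul_iff_left two_ne_zero).1 h3)

end ReedMuller

/-! ### Weighted sums of bits modulo powers of two -/

section BitWeight

variable {m : ℕ}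

/-- The integer `∑ x, w x * f x`, the bits of `f` being lifted to `0, 1 : ℤ`. -/
def bitWeight (w : Cube m → ℤ) (f : Cube m → ZMod 2) : ℤ := ∑ x, w x * (f x).val

@[simp] lemma bitWeight_zero (w : Cube m → ℤ) : bitWeight w 0 = 0 := by simp [bitWeight]

/-- The weights of the signed operator: `(-1) ^ |x|` on `A`. -/
def signedWeight (A : Finset (Cube m)) (x : Cube m) : ℤ :=
  if x ∈ A then bitSign (parity x) else 0

/-- The weights of the unsigned operator: `1` on `A`. -/
def unsignedWeight (A : Finset (Cube m)) (x : Cube m) : ℤ := if x ∈ A then 1 else 0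

lemma bitWeight_signed_add (A B : Finset (Cube m)) (f : Cube m → ZMod 2) :
    bitWeight (signedWeight A) (f + bitIndicator B) =
      bitWeight (signedWeight A) f + signedSum (A ∩ B) f := by
  have h : signedSum (A ∩ B) f =
      ∑ x, if x ∈ A ∧ x ∈ B then bitSign (parity x) * bitSign (f x) else 0 := by
    rw [← Finset.sum_filter, signedSum]
    congr 1
    ext x
    simp
  rw [h, bitWeight, bitWeight, ← Finset.sum_add_distrib]
  refine Finset.sum_congr rfl fun x _ => ?_
  rw [Pi.add_apply, val_add_bit, bitIndicator, signedWeight]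
  by_cases hA : x ∈ A <;> by_cases hB : x ∈ B <;> simp [hA, hB, ZMod.val_one, mul_add]

/-- Complementing the bits at the vertices of odd weight turns the unsigned into the signed
weight, up to a constant. -/
lemma bitWeight_unsigned (A : Finset (Cube m)) (f : Cube m → ZMod 2) :
    bitWeight (unsignedWeight A) f =
      bitWeight (signedWeight A) (f + parity) - bitWeight (signedWeight A) parity := by
  have h : ∀ c e : ZMod 2,
      (c.val : ℤ) = bitSign e * (c + e).val - bitSign e * e.val := by decide
  rw [bitWeight, bitWeight, bitWeight, ← Finset.sum_sub_distrib]
  refine Finset.sum_congr rfl fun x _ => ?_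
  rw [unsignedWeight, signedWeight, Pi.add_apply]
  split_ifs
  · rw [one_mul]
    exact h _ _
  · ring

variable {q r : ℕ} (k : ℕ) (a : Cube m) (K : Finset (Fin m))

/-- The divisibility condition for preserving the code: the difference is a signed sum over the
intersection with `face b L`, whose dimension is smaller by at most `q`, with equality for a
suitable `L` unless the intersection is a single vertex. -/
theorem dvd_bitWeight_signed_sub_iff (hr : r ≤ m) (hqr : q ≤ r) :
    (∀ f ∈ reedMuller m r, ∀ (b : Cube m) (L : Finset (Fin m)), L.card = q →
      2 ^ (k + 1) ∣ bitWeight (signedWeight (face a K)) (f + bitIndicator (face b L)) -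
        bitWeight (signedWeight (face a K)) f) ↔ K.card + (q + k * r + 1) ≤ m := by
  simp only [bitWeight_signed_add, add_sub_cancel_left]
  constructor
  · intro h
    by_contra! hlt
    obtain ⟨L, hL, hKL⟩ := exists_card_union K (hqr.trans hr)
    obtain ⟨f, hf, hdvd⟩ := exists_not_dvd_signedSum hr k a (K ∪ L) (by omega)
    exact hdvd (face_inter_self a K L ▸ h f hf a L hL)
  · intro hle f hf b L hL
    rcases face_inter a b K L with h | ⟨c, hc⟩
    · rw [h, signedSum_empty]; exact dvd_zero _
    · rw [hc]
      have := Finset.card_union_le K L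
      exact dvd_signedSum hf k c _ (by omega)

/-- The divisibility condition for fixing the code pointwise reduces to the case `q = r` of
`dvd_bitWeight_signed_sub_iff`, since functions of order `r` are reached from `0` by successive
translations. -/
theorem dvd_bitWeight_signed_iff (hr : r ≤ m) :
    (∀ f ∈ reedMuller m r, 2 ^ (k + 1) ∣ bitWeight (signedWeight (face a K)) f) ↔
      K.card + ((k + 1) * r + 1) ≤ m := by
  constructor
  · intro h
    have := (dvd_bitWeight_signed_sub_iff k a K hr le_rfl).1 fun f hf b L hL =>
      dvd_sub (h _ (add_mem hf (bitIndicator_mem_reedMuller b hL.le))) (h f hf)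
    rw [add_one_mul]
    omega
  · intro hle f hf
    induction hf using reedMuller_induction with
    | zero => simp
    | add f b L hf hL ih =>
      have := (dvd_bitWeight_signed_sub_iff (q := L.card) k a K hr hL).2
        (by rw [add_one_mul] at hle; omega) f hf b L rfl
      exact (dvd_sub_left ih).1 this

theorem dvd_bitWeight_unsigned_sub_iff (hpos : 0 < r) (A : Finset (Cube m)) :
    (∀ f ∈ reedMuller m r, ∀ (b : Cube m) (L : Finset (Fin m)), L.card = q →
      2 ^ (k + 1) ∣ bitWeight (unsignedWeight A) (f + bitIndicator (face b L)) -
        bitWeight (unsignedWeight A) f) ↔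
    ∀ f ∈ reedMuller m r, ∀ (b : Cube m) (L : Finset (Fin m)), L.card = q →
      2 ^ (k + 1) ∣ bitWeight (signedWeight A) (f + bitIndicator (face b L)) -
        bitWeight (signedWeight A) f := by
  have hp := parity_mem_reedMuller (m := m) hpos
  simp only [bitWeight_unsigned, sub_sub_sub_cancel_right]
  constructor
  · intro h f hf b L hL
    have := h _ (add_mem hf hp) b L hL
    rwa [add_right_comm f, add_assoc _ parity, ZModModule.add_self, add_zero, add_assoc f,
      ZModModule.add_self, add_zero] at this
  · intro h f hf b L hL
    rw [add_right_comm]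
    exact h _ (add_mem hf hp) b L hL

theorem dvd_bitWeight_unsigned_iff (hpos : 0 < r) (A : Finset (Cube m)) :
    (∀ f ∈ reedMuller m r, 2 ^ (k + 1) ∣ bitWeight (unsignedWeight A) f) ↔
    ∀ f ∈ reedMuller m r, 2 ^ (k + 1) ∣ bitWeight (signedWeight A) f := by
  have hp := parity_mem_reedMuller (m := m) hpos
  simp only [bitWeight_unsigned]
  constructor
  · intro h f hf
    have h1 := h _ (add_mem hf hp)
    have h0 := h _ hp
    rw [add_assoc, ZModModule.add_self, add_zero] at h1
    rw [ZModModule.add_self, bitWeight_zero, zero_sub, dvd_neg] at h0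
    exact (dvd_sub_left h0).1 h1
  · intro h f hf
    exact dvd_sub (h _ (add_mem hf hp)) (h _ hp)

end BitWeight

open scoped ComplexConjugate

/-! ### Tensor products of single-qubit operators -/

section TensorOp

variable {ι : Type} [Fintype ι]

lemma tensorOp_one : tensorOp (fun _ : ι => (1 : Matrix (Fin 2) (Fin 2) ℂ)) = 1 := by
  ext b c
  simp [tensorOp, Matrix.one_apply, Finset.prod_ite_zero, funext_iff]

lemma tensorOp_conjTranspose (U : ι → Matrix (Fin 2) (Fin 2) ℂ) :
    (tensorOp U)ᴴ = tensorOp fun x => (U x)ᴴ := by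
  ext b c
  simp [tensorOp]

variable [DecidableEq ι]

lemma tensorOp_mul (U V : ι → Matrix (Fin 2) (Fin 2) ℂ) :
    tensorOp U * tensorOp V = tensorOp fun x => U x * V x := by
  ext b c
  simp only [tensorOp, Matrix.mul_apply, Matrix.of_apply, ← Finset.prod_mul_distrib]
  rw [Finset.prod_univ_sum, Fintype.piFinset_univ]

lemma tensorOp_mem_unitaryGroup {U : ι → Matrix (Fin 2) (Fin 2) ℂ}
    (hU : ∀ x, U x * (U x)ᴴ = 1) : tensorOp U ∈ Matrix.unitaryGroup (ι → Fin 2) ℂ := by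
  rw [Matrix.mem_unitaryGroup_iff, Matrix.star_eq_conjTranspose, tensorOp_conjTranspose,
    tensorOp_mul]
  simp only [hU, tensorOp_one]

/-- A tensor product of monomial matrices, the row `b` of the factor at `x` having its only
nonzero entry `w x b` in the column `σ x b`. -/
lemma tensorOp_monomial_mulVec {U : ι → Matrix (Fin 2) (Fin 2) ℂ} {σ : ι → Fin 2 → Fin 2}
    {w : ι → Fin 2 → ℂ} (hU : ∀ x b c, U x b c = if c = σ x b then w x b else 0)
    (ψ : State ι) (b : ι → Fin 2) :
    (tensorOp U *ᵥ ψ) b = (∏ x, w x (b x)) * ψ fun x => σ x (b x) := by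
  simp only [Matrix.mulVec, dotProduct, tensorOp, Matrix.of_apply, hU, Finset.prod_ite_zero,
    Finset.mem_univ, forall_const]
  rw [Finset.sum_eq_single fun x => σ x (b x)]
  · simp
  · intro c _ hc
    rw [if_neg fun h => hc (funext h), zero_mul]
  · simp

end TensorOp

/-! ### Monomial gates in the Clifford hierarchy -/

section Hierarchy

/-- Diagonal and antidiagonal `2 × 2` matrices whose entries are powers of `e^{iπ/2^{k+1}}` and
have a power of `e^{iπ/2^k}` as their ratio: the products of powers of `X` and `Z(k)` and of a
phase. -/
def monomialGates (k : ℕ) : Set (Matrix (Fin 2) (Fin 2) ℂ) :=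
  {M | ∃ α β : ℂ, α ^ 2 ^ (k + 2) = 1 ∧ α ^ 2 ^ (k + 1) = β ^ 2 ^ (k + 1) ∧
    (M = !![α, 0; 0, β] ∨ M = !![0, α; β, 0])}

lemma singlePauliGroup_eq : singlePauliGroup = monomialGates 0 := by
  ext M
  constructor
  · rintro ⟨c, hc, P, hP, rfl⟩
    have h4 : c ^ 4 = 1 := by
      rcases hc with rfl | rfl | rfl | rfl
      · norm_num
      · norm_num
      · exact Complex.I_pow_four
      · rw [neg_pow, Complex.I_pow_four]; norm_num
    rcases hP with rfl | rfl | rfl | rfl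
    · exact ⟨c, c, by simpa using h4, rfl, .inl (by simp [Matrix.one_fin_two])⟩
    · exact ⟨c, c, by simpa using h4, rfl, .inr (by simp [pauliX])⟩
    · refine ⟨c * -Complex.I, c * Complex.I, ?_, by ring, .inr (by simp [pauliY])⟩
      rw [mul_pow, neg_pow, zero_add, show 2 ^ 2 = 4 from rfl, h4, Complex.I_pow_four]
      norm_num
    · exact ⟨c, -c, by simpa using h4, by ring, .inl (by simp [pauliZ])⟩
  · rintro ⟨α, β, hα, hαβ, hM⟩
    have hα' : α ∈ ({1, -1, Complex.I, -Complex.I} : Set ℂ) := by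
      have : (α ^ 2 - 1 ^ 2) * (α ^ 2 - Complex.I ^ 2) = 0 := by
        rw [Complex.I_sq]; linear_combination hα
      rcases mul_eq_zero.1 this with h | h <;> rw [sub_eq_zero, sq_eq_sq_iff_eq_or_eq_neg] at h <;>
        rcases h with h | h <;> simp [h]
    have hαI : α * Complex.I ∈ ({1, -1, Complex.I, -Complex.I} : Set ℂ) := by
      rcases hα' with rfl | rfl | rfl | rfl <;> simp
    have hβ : β = α ∨ β = -α := by
      rw [← sq_eq_sq_iff_eq_or_eq_neg]; simpa using hαβ.symm
    rcases hM with rfl | rfl <;> rcases hβ with rfl | rfl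
    · exact ⟨β, hα', 1, by simp, by simp [Matrix.one_fin_two]⟩
    · exact ⟨α, hα', pauliZ, by simp, by simp [pauliZ]⟩
    · exact ⟨β, hα', pauliX, by simp, by simp [pauliX]⟩
    · refine ⟨α * Complex.I, hαI, pauliY, by simp, ?_⟩
      simp [pauliY, mul_assoc]

lemma monomialGates_subset_succ (k : ℕ) : monomialGates k ⊆ monomialGates (k + 1) := by
  rintro M ⟨α, β, hα, hαβ, hM⟩
  refine ⟨α, β, ?_, ?_, hM⟩
  · rw [pow_succ 2 (k + 2), pow_mul, hα, one_pow]
  · rw [pow_succ 2 (k + 1), pow_mul, hαβ, pow_mul]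

lemma mul_star_of_pow_eq_one {α : ℂ} {n : ℕ} (h : α ^ 2 ^ n = 1) : α * conj α = 1 := by
  have := Complex.norm_eq_one_of_pow_eq_one h (by positivity)
  simp [Complex.mul_conj, Complex.normSq_eq_norm_sq, this]

lemma monomialGates_mul_conjTranspose {k : ℕ} {M : Matrix (Fin 2) (Fin 2) ℂ}
    (hM : M ∈ monomialGates k) : M * Mᴴ = 1 := by
  obtain ⟨α, β, hα, hαβ, hM⟩ := hM
  have hβ : β ^ 2 ^ (k + 2) = 1 := by
    rw [pow_succ 2 (k + 1), pow_mul, ← hαβ, ← pow_mul, ← pow_succ, hα]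
  have h1 := mul_star_of_pow_eq_one hα
  have h2 := mul_star_of_pow_eq_one hβ
  rcases hM with rfl | rfl <;> ext i j <;> fin_cases i <;> fin_cases j <;>
    simp [Matrix.mul_apply, h1, h2]

/-- Conjugating a Pauli operator by a monomial gate of level `k + 1` squares the ratio of the two
entries of the gate and so gives a monomial gate of level `k`. -/
lemma conj_mem_monomialGates {k : ℕ} {U Q : Matrix (Fin 2) (Fin 2) ℂ}
    (hU : U ∈ monomialGates (k + 1)) (hQ : Q ∈ monomialGates 0) :
    U * Q * Uᴴ ∈ monomialGates k := by
  obtain ⟨α, β, hα, hαβ, hU⟩ := hU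
  obtain ⟨γ, δ, hγ, hγδ, hQ⟩ := hQ
  have hβ : β ^ 2 ^ (k + 3) = 1 := by
    rw [pow_succ 2 (k + 2), pow_mul, ← hαβ, ← pow_mul, ← pow_succ, hα]
  have hα1 := mul_star_of_pow_eq_one hα
  have hβ1 := mul_star_of_pow_eq_one hβ
  have hδ : δ ^ 2 ^ (0 + 2) = 1 := by
    rw [pow_succ 2 (0 + 1), pow_mul, ← hγδ, ← pow_mul, ← pow_succ, hγ]
  -- The entries of `Q` satisfy the conditions of every level.
  have lift4 : ∀ c : ℂ, c ^ 2 ^ (0 + 2) = 1 → c ^ 2 ^ (k + 2) = 1 := by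
    intro c hc
    rw [add_comm k 2, pow_add, pow_mul, ← zero_add 2, hc, one_pow]
  have lift2 : γ ^ 2 ^ (k + 1) = δ ^ 2 ^ (k + 1) := by
    rw [add_comm k 1, pow_add, pow_mul, pow_mul δ, ← zero_add 1, hγδ]
  have hpa : α ^ 2 ^ (k + 1) * conj α ^ 2 ^ (k + 1) = 1 := by rw [← mul_pow, hα1, one_pow]
  have hpb : β ^ 2 ^ (k + 1) * conj β ^ 2 ^ (k + 1) = 1 := by rw [← mul_pow, hβ1, one_pow]
  have hab : α ^ 2 ^ (k + 2) * conj β ^ 2 ^ (k + 2) = 1 := by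
    rw [hαβ, ← mul_pow, hβ1, one_pow]
  -- The squares of `α ^ 2 ^ (k + 1)` and `β ^ 2 ^ (k + 1)` agree.
  have hsq : α ^ 2 ^ (k + 1) * conj β ^ 2 ^ (k + 1) = β ^ 2 ^ (k + 1) * conj α ^ 2 ^ (k + 1) := by
    rw [pow_succ 2 (k + 1), pow_mul, pow_mul β] at hαβ
    linear_combination (-(α ^ 2 ^ (k + 1) * conj β ^ 2 ^ (k + 1))) * hpa +
      (conj α ^ 2 ^ (k + 1) * conj β ^ 2 ^ (k + 1)) * hαβ +
      (β ^ 2 ^ (k + 1) * conj α ^ 2 ^ (k + 1)) * hpb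
  have main : ∀ c e : ℂ, c ^ 2 ^ (k + 2) = 1 → c ^ 2 ^ (k + 1) = e ^ 2 ^ (k + 1) →
      !![0, α * c * conj β; β * e * conj α, 0] ∈ monomialGates k := by
    intro c e hc hce
    refine ⟨_, _, ?_, ?_, .inr rfl⟩
    · rw [mul_pow, mul_pow, hc, mul_one, hab]
    · rw [mul_pow, mul_pow, mul_pow, mul_pow, ← hce]
      linear_combination c ^ 2 ^ (k + 1) * hsq
  rcases hU with rfl | rfl <;> rcases hQ with rfl | rfl
  · refine ⟨γ, δ, lift4 γ hγ, lift2, .inl ?_⟩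
    ext i j
    fin_cases i <;> fin_cases j <;> simp [Matrix.mul_apply, Fin.sum_univ_two]
    · linear_combination γ * hα1
    · linear_combination δ * hβ1
  · convert main γ δ (lift4 γ hγ) lift2 using 1
    ext i j
    fin_cases i <;> fin_cases j <;> simp [Matrix.mul_apply, Fin.sum_univ_two]
  · refine ⟨δ, γ, lift4 δ hδ, lift2.symm, .inl ?_⟩
    ext i j
    fin_cases i <;> fin_cases j <;> simp [Matrix.mul_apply, Fin.sum_univ_two]
    · linear_combination δ * hα1
    · linear_combination γ * hβ1
  · convert main δ γ (lift4 δ hδ) lift2.symm using 1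
    ext i j
    fin_cases i <;> fin_cases j <;> simp [Matrix.mul_apply, Fin.sum_univ_two]

variable {ι : Type} [Fintype ι]

lemma mem_pauliGroup_iff {P : Operator ι} : P ∈ pauliGroup ι ↔
    ∃ Q : ι → Matrix (Fin 2) (Fin 2) ℂ, (∀ x, Q x ∈ monomialGates 0) ∧ P = tensorOp Q := by
  rw [pauliGroup, singlePauliGroup_eq]; rfl

variable [DecidableEq ι]

lemma conj_tensorOp (U Q : ι → Matrix (Fin 2) (Fin 2) ℂ) :
    tensorOp U * tensorOp Q * (tensorOp U)ᴴ = tensorOp fun x => U x * Q x * (U x)ᴴ := by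
  rw [tensorOp_conjTranspose, tensorOp_mul, tensorOp_mul]

lemma tensorOp_mem_unitaryGroup_of_monomialGates {k : ℕ} {U : ι → Matrix (Fin 2) (Fin 2) ℂ}
    (hU : ∀ x, U x ∈ monomialGates k) : tensorOp U ∈ Matrix.unitaryGroup (ι → Fin 2) ℂ :=
  tensorOp_mem_unitaryGroup fun x => monomialGates_mul_conjTranspose (hU x)

theorem tensorOp_mem_cliffordHierarchy {k : ℕ} {U : ι → Matrix (Fin 2) (Fin 2) ℂ}
    (hU : ∀ x, U x ∈ monomialGates k) : tensorOp U ∈ cliffordHierarchy ι k := by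
  induction k generalizing U with
  | zero => exact mem_pauliGroup_iff.2 ⟨U, hU, rfl⟩
  | succ k ih =>
    refine ⟨tensorOp_mem_unitaryGroup_of_monomialGates hU, fun P hP => ?_⟩
    obtain ⟨Q, hQ, rfl⟩ := mem_pauliGroup_iff.1 hP
    rw [conj_tensorOp]
    exact ih fun x => conj_mem_monomialGates (hU x) (hQ x)

/-- The conjugate of a Pauli operator lies one level lower, where level `-1` means level `0`. -/
lemma conj_tensorOp_mem_cliffordHierarchy {k : ℕ} {U : ι → Matrix (Fin 2) (Fin 2) ℂ}
    (hU : ∀ x, U x ∈ monomialGates k) {P : Operator ι} (hP : P ∈ pauliGroup ι) :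
    tensorOp U * P * (tensorOp U)ᴴ ∈ cliffordHierarchy ι (k - 1) := by
  obtain ⟨Q, hQ, rfl⟩ := mem_pauliGroup_iff.1 hP
  rw [conj_tensorOp]
  refine tensorOp_mem_cliffordHierarchy fun x => conj_mem_monomialGates ?_ (hQ x)
  cases k with
  | zero => exact monomialGates_subset_succ 0 (hU x)
  | succ k => exact hU x

end Hierarchy

/-! ### Undetectable errors of Pauli stabilizer codes -/

section Undetectable

variable {ι : Type} [Fintype ι] [DecidableEq ι]

/-- A unitary operator that preserves a code maps it onto itself, the dimension being finite. -/
lemma PreservesCode.conjTranspose {C : Submodule ℂ (State ι)} {U : Operator ι}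
    (hU : Uᴴ * U = 1) (h : PreservesCode C U) : PreservesCode C Uᴴ := by
  have hinv : ∀ ψ, Uᴴ *ᵥ (U *ᵥ ψ) = ψ := fun ψ => by
    rw [Matrix.mulVec_mulVec, hU, Matrix.one_mulVec]
  let T : C →ₗ[ℂ] C := (Matrix.mulVecLin U).restrict h
  have hT : Function.Injective T := by
    intro φ φ' hφ
    have := congrArg (fun χ : C => Uᴴ *ᵥ (χ : State ι)) hφ
    change Uᴴ *ᵥ (U *ᵥ (φ : State ι)) = Uᴴ *ᵥ (U *ᵥ (φ' : State ι)) at this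
    rw [hinv, hinv] at this
    exact Subtype.ext this
  intro ψ hψ
  obtain ⟨φ, hφ⟩ := LinearMap.injective_iff_surjective.1 hT ⟨ψ, hψ⟩
  have : U *ᵥ (φ : State ι) = ψ := congrArg Subtype.val hφ
  rw [← this, hinv]
  exact φ.2

/-- For a code stabilized by Pauli operators, an operator built from monomial gates of level `k`
is undetectable at level `k` if and only if it preserves the code. -/
theorem tensorOp_mem_undetectableErrors_iff {C : Submodule ℂ (State ι)} {S : Set (Operator ι)}
    (hS : S ⊆ pauliGroup ι) (hC : ∀ ψ, ψ ∈ C ↔ ∀ P ∈ S, P *ᵥ ψ = ψ) {k : ℕ}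
    {V : ι → Matrix (Fin 2) (Fin 2) ℂ} (hV : ∀ x, V x ∈ monomialGates k) :
    tensorOp V ∈ undetectableErrors C k ↔ PreservesCode C (tensorOp V) := by
  have hunit := tensorOp_mem_unitaryGroup_of_monomialGates hV
  have h1 : tensorOp V * (tensorOp V)ᴴ = 1 := Matrix.mem_unitaryGroup_iff.1 hunit
  have h2 : (tensorOp V)ᴴ * tensorOp V = 1 := Matrix.mem_unitaryGroup_iff'.1 hunit
  have hhier := @conj_tensorOp_mem_cliffordHierarchy ι _ _ k V hV
  have hmem := tensorOp_mem_cliffordHierarchy hV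
  generalize tensorOp V = U at *
  constructor
  · rintro ⟨-, h⟩
    have hpres : PreservesCode C Uᴴ := by
      intro ψ hψ
      rw [hC]
      intro P hP
      have := (h P ⟨hS hP, fun φ hφ => (hC φ).1 hφ P hP⟩).2 ψ hψ
      calc P *ᵥ (Uᴴ *ᵥ ψ) = Uᴴ *ᵥ ((U * P * Uᴴ) *ᵥ ψ) := by
            simp only [Matrix.mulVec_mulVec, ← mul_assoc, h2, one_mul]
        _ = Uᴴ *ᵥ ψ := by rw [this]
    have := hpres.conjTranspose (by rwa [Matrix.conjTranspose_conjTranspose])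
    rwa [Matrix.conjTranspose_conjTranspose] at this
  · intro h
    refine ⟨hmem, fun P hP => ⟨hhier hP.1, fun ψ hψ => ?_⟩⟩
    rw [← Matrix.mulVec_mulVec, ← Matrix.mulVec_mulVec, hP.2 _ (h.conjTranspose h2 ψ hψ),
      Matrix.mulVec_mulVec, h1, Matrix.one_mulVec]

end Undetectable

/-! ### Code states -/

section Code

variable {m q r : ℕ}

/-- The Pauli generators of the stabilizer group of the quantum Reed–Muller code. -/
def stabilizerGenerators (m q r : ℕ) : Set (Operator (Cube m)) :=
  stabilizerGeneratorsX m q ∪ stabilizerGeneratorsZ m r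

lemma transversal_mem_pauliGroup {P : Matrix (Fin 2) (Fin 2) ℂ} (hP : P ∈ singlePauliGroup)
    (A : Set (Cube m)) : transversal P A ∈ pauliGroup (Cube m) := by
  refine ⟨_, fun x => ?_, rfl⟩
  split_ifs
  · exact hP
  · exact ⟨1, by simp, 1, by simp, by simp⟩

lemma stabilizerGenerators_subset : stabilizerGenerators m q r ⊆ pauliGroup (Cube m) := by
  rintro U (⟨A, -, rfl⟩ | ⟨A, -, rfl⟩)
  · exact transversal_mem_pauliGroup ⟨1, by simp, pauliX, by simp, by simp⟩ A
  · exact transversal_mem_pauliGroup ⟨1, by simp, pauliZ, by simp, by simp⟩ A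

lemma mem_code_iff_stabilizerGenerators (ψ : State (Cube m)) :
    ψ ∈ code m q r ↔ ∀ U ∈ stabilizerGenerators m q r, U *ᵥ ψ = ψ := by
  refine ⟨fun h U hU => h U (Submonoid.subset_closure hU), fun h U hU => ?_⟩
  induction hU using Submonoid.closure_induction with
  | mem V hV => exact h V hV
  | one => exact Matrix.one_mulVec ψ
  | mul V W _ _ hV hW => rw [← Matrix.mulVec_mulVec, hW, hV]

/-- The amplitude of `ψ` at the basis state labelled by `f`. The labels of basis states are
regarded as functions to the field `ZMod 2`, which has the same elements as `Fin 2`. -/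
def amplitude (ψ : State (Cube m)) (f : Cube m → ZMod 2) : ℂ := ψ f

lemma ext_amplitude {ψ φ : State (Cube m)} (h : ∀ f, amplitude ψ f = amplitude φ f) : ψ = φ :=
  funext h

lemma amplitude_tensorOp_mulVec {U : Cube m → Matrix (Fin 2) (Fin 2) ℂ}
    {σ : Cube m → ZMod 2 → ZMod 2} {w : Cube m → ZMod 2 → ℂ}
    (hU : ∀ (x : Cube m) (b c : ZMod 2), U x b c = if c = σ x b then w x b else 0)
    (ψ : State (Cube m)) (f : Cube m → ZMod 2) :
    amplitude (tensorOp U *ᵥ ψ) f =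
      (∏ x, w x (f x)) * amplitude ψ fun x => σ x (f x) :=
  tensorOp_monomial_mulVec hU ψ f

lemma forall_bit {p : ZMod 2 → Prop} (h0 : p 0) (h1 : p 1) : ∀ b, p b :=
  Fin.forall_fin_two.2 ⟨h0, h1⟩

lemma amplitude_tensorOp_diagonal_mulVec {U : Cube m → Matrix (Fin 2) (Fin 2) ℂ}
    {w : Cube m → ZMod 2 → ℂ} (hU : ∀ x, U x = !![w x 0, 0; 0, w x 1])
    (ψ : State (Cube m)) (f : Cube m → ZMod 2) :
    amplitude (tensorOp U *ᵥ ψ) f = (∏ x, w x (f x)) * amplitude ψ f := by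
  refine amplitude_tensorOp_mulVec (σ := fun _ b => b) (fun x => ?_) ψ f
  rw [hU]
  exact forall_bit (forall_bit (if_pos (by decide)).symm (if_neg (by decide)).symm)
    (forall_bit (if_neg (by decide)).symm (if_pos (by decide)).symm)

lemma amplitude_transversal_pauliX (B : Finset (Cube m)) (ψ : State (Cube m))
    (f : Cube m → ZMod 2) :
    amplitude (transversal pauliX (B : Set (Cube m)) *ᵥ ψ) f =
      amplitude ψ (f + bitIndicator B) := by
  rw [transversal, amplitude_tensorOp_mulVec (σ := fun x b => b + bitIndicator B x)
    (w := fun _ _ => 1)]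
  · rw [Finset.prod_const_one, one_mul]
    rfl
  · intro x
    by_cases hx : x ∈ B
    · simp only [Finset.mem_coe, bitIndicator, if_pos hx]
      exact forall_bit (forall_bit (if_neg (by decide)).symm (if_pos (by decide)).symm)
        (forall_bit (if_pos (by decide)).symm (if_neg (by decide)).symm)
    · simp only [Finset.mem_coe, bitIndicator, if_neg hx, Matrix.one_fin_two]
      exact forall_bit (forall_bit (if_pos (by decide)).symm (if_neg (by decide)).symm)
        (forall_bit (if_neg (by decide)).symm (if_pos (by decide)).symm)

lemma amplitude_transversal_pauliZ (B : Finset (Cube m)) (ψ : State (Cube m))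
    (f : Cube m → ZMod 2) :
    amplitude (transversal pauliZ (B : Set (Cube m)) *ᵥ ψ) f =
      bitSign (∑ x ∈ B, f x) * amplitude ψ f := by
  rw [transversal, amplitude_tensorOp_diagonal_mulVec
    (w := fun x b => if x ∈ B then (bitSign b : ℂ) else 1)]
  · have hprod : ∀ s : Finset (Cube m), bitSign (∑ x ∈ s, f x) = ∏ x ∈ s, bitSign (f x) := by
      intro s
      induction s using Finset.cons_induction with
      | empty => rfl
      | cons x s hx ih => rw [Finset.sum_cons, Finset.prod_cons, bitSign_add, ih]
    rw [hprod, Int.cast_prod, Finset.prod_ite_mem, Finset.univ_inter]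
  · intro x
    by_cases hx : x ∈ B <;> simp [hx, pauliZ, bitSign, Matrix.one_fin_two]

/-- Code states are supported on the Reed–Muller code of order `r` and invariant under the
translations that generate the Reed–Muller code of order `q`. -/
theorem mem_code_iff (hq : q ≤ m) (ψ : State (Cube m)) :
    ψ ∈ code m q r ↔
      (∀ (a : Cube m) (L : Finset (Fin m)), L.card = q → ∀ f,
        amplitude ψ (f + bitIndicator (face a L)) = amplitude ψ f) ∧
      ∀ f, amplitude ψ f ≠ 0 → f ∈ reedMuller m r := by
  rw [mem_code_iff_stabilizerGenerators]
  constructor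
  · intro h
    constructor
    · intro a L hL f
      rw [← amplitude_transversal_pauliX,
        h _ (.inl ⟨_, isSubcube_iff.2 ⟨a, L, by omega, rfl⟩, rfl⟩)]
    · intro f hf
      rw [mem_reedMuller_iff]
      intro a K hK
      have h1 := congrArg (amplitude · f)
        (h _ (.inr ⟨_, isSubcube_iff.2 ⟨a, K, hK, rfl⟩, rfl⟩))
      simp only [amplitude_transversal_pauliZ] at h1
      rw [mul_eq_right₀ hf] at h1
      by_contra hne
      rw [bitSign, if_neg hne] at h1
      norm_num at h1
  · rintro ⟨hX, hZ⟩ U (⟨A, hA, rfl⟩ | ⟨A, hA, rfl⟩) <;>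
      obtain ⟨a, K, hK, rfl⟩ := isSubcube_iff.1 hA <;> refine ext_amplitude fun f => ?_
    · rw [amplitude_transversal_pauliX, hX a K (by omega) f]
    · rw [amplitude_transversal_pauliZ]
      by_cases hf : amplitude ψ f = 0
      · rw [hf, mul_zero]
      · rw [mem_reedMuller_iff.1 (hZ f hf) a K hK, bitSign_zero, Int.cast_one, one_mul]

open Classical in
/-- The uniform superposition of the coset of `f` modulo the Reed–Muller code of order `q`
(not normalized). -/
noncomputable def cosetState (q : ℕ) (f : Cube m → ZMod 2) : State (Cube m) :=
  fun g : Cube m → ZMod 2 => if g - f ∈ reedMuller m q then 1 else 0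

open Classical in
lemma amplitude_cosetState (f g : Cube m → ZMod 2) :
    amplitude (cosetState q f) g = if g - f ∈ reedMuller m q then 1 else 0 := rfl

lemma amplitude_cosetState_self (f : Cube m → ZMod 2) : amplitude (cosetState q f) f = 1 := by
  rw [amplitude_cosetState, sub_self, if_pos (zero_mem _)]

lemma cosetState_mem_code (hqr : q ≤ r) (hrm : r ≤ m) {f : Cube m → ZMod 2}
    (hf : f ∈ reedMuller m r) : cosetState q f ∈ code m q r := by
  rw [mem_code_iff (hqr.trans hrm)]
  constructor
  · intro a L hL g
    rw [amplitude_cosetState, amplitude_cosetState, add_sub_right_comm]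
    congr 1
    exact propext (add_mem_cancel_right (bitIndicator_mem_reedMuller a hL.le))
  · intro g hg
    have hg' : g - f ∈ reedMuller m q := by
      by_contra hne
      exact hg (by rw [amplitude_cosetState, if_neg hne])
    simpa using add_mem (reedMuller_mono hqr hg') hf

end Code

/-! ### Diagonal phase operators -/

section Phase

variable {m q r : ℕ}

/-- The phase `e^{iπ/2^k}`. -/
noncomputable def zPhase (k : ℕ) : ℂ := Complex.exp (Complex.I * (Real.pi / 2 ^ k))

lemma zPhase_ne_zero (k : ℕ) : zPhase k ≠ 0 := Complex.exp_ne_zero _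

lemma isPrimitiveRoot_zPhase (k : ℕ) : IsPrimitiveRoot (zPhase k) (2 ^ (k + 1)) := by
  convert Complex.isPrimitiveRoot_exp (2 ^ (k + 1)) (by positivity) using 1
  rw [zPhase]
  congr 1
  push_cast
  field_simp
  ring

lemma conj_zPhase (k : ℕ) : (starRingEnd ℂ) (zPhase k) = (zPhase k)⁻¹ := by
  rw [Complex.inv_eq_conj (Complex.norm_eq_one_of_pow_eq_one
    (isPrimitiveRoot_zPhase k).pow_eq_one (by positivity))]

/-- The single-qubit gate `Z(k) ^ n`. -/
noncomputable def zGatePow (k : ℕ) (n : ℤ) : Matrix (Fin 2) (Fin 2) ℂ := !![1, 0; 0, zPhase k ^ n]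

lemma zGatePow_mem_monomialGates (k : ℕ) (n : ℤ) : zGatePow k n ∈ monomialGates k := by
  refine ⟨1, zPhase k ^ n, one_pow _, ?_, .inl rfl⟩
  have h : zPhase k ^ 2 ^ (k + 1) = 1 := (isPrimitiveRoot_zPhase k).pow_eq_one
  rw [one_pow, ← zpow_natCast, zpow_comm, zpow_natCast, h, one_zpow]

lemma signedZ_eq (k : ℕ) (A : Finset (Cube m)) :
    signedZ k (A : Set (Cube m)) = tensorOp fun x => zGatePow k (signedWeight A x) := by
  have h : (zGate k)ᴴ = zGatePow k (-1) := by
    change (!![1, 0; 0, zPhase k] : Matrix (Fin 2) (Fin 2) ℂ)ᴴ = _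
    ext i j
    fin_cases i <;> fin_cases j <;> simp [zGatePow, conj_zPhase]
  rw [signedZ, h]
  congr 1
  ext1 x
  simp only [Finset.mem_coe, even_hammingNorm_iff, signedWeight, bitSign]
  split_ifs <;> simp [zGate, zGatePow, zPhase, Matrix.one_fin_two]

lemma unsignedZ_eq (k : ℕ) (A : Finset (Cube m)) :
    unsignedZ k (A : Set (Cube m)) = tensorOp fun x => zGatePow k (unsignedWeight A x) := by
  rw [unsignedZ, transversal]
  congr 1
  ext1 x
  simp only [Finset.mem_coe, unsignedWeight]
  split_ifs <;> simp [zGate, zGatePow, zPhase, Matrix.one_fin_two]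

variable (k : ℕ) (w : Cube m → ℤ)

lemma amplitude_tensorOp_zGatePow (ψ : State (Cube m)) (f : Cube m → ZMod 2) :
    amplitude ((tensorOp fun x => zGatePow k (w x)) *ᵥ ψ) f =
      zPhase k ^ bitWeight w f * amplitude ψ f := by
  rw [amplitude_tensorOp_diagonal_mulVec
    (w := fun x b => zPhase k ^ (w x * b.val))]
  · have hprod : ∀ (s : Finset (Cube m)) (n : Cube m → ℤ),
        zPhase k ^ ∑ x ∈ s, n x = ∏ x ∈ s, zPhase k ^ n x := by
      intro s n
      induction s using Finset.cons_induction with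
      | empty => simp
      | cons x s hx ih =>
        rw [Finset.sum_cons, Finset.prod_cons, zpow_add₀ (zPhase_ne_zero k), ih]
    rw [bitWeight, hprod]
  · intro x
    simp [zGatePow, ZMod.val_one]

lemma zPhase_zpow_eq_one_iff (n : ℤ) : zPhase k ^ n = 1 ↔ 2 ^ (k + 1) ∣ n := by
  rw [(isPrimitiveRoot_zPhase k).zpow_eq_one_iff_dvd]
  norm_num

lemma zPhase_zpow_eq_iff (n n' : ℤ) : zPhase k ^ n = zPhase k ^ n' ↔ 2 ^ (k + 1) ∣ n - n' := by
  rw [← zPhase_zpow_eq_one_iff, zpow_sub₀ (zPhase_ne_zero k),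
    div_eq_one_iff_eq (zpow_ne_zero _ (zPhase_ne_zero k))]

/-- The phase operator fixes the code pointwise if and only if all phases on the support of the
code are trivial. -/
theorem tensorOp_mem_cliffordStabilizers_iff (hqr : q ≤ r) (hrm : r ≤ m) :
    (tensorOp fun x => zGatePow k (w x)) ∈ cliffordStabilizers (code m q r) k ↔
      ∀ f ∈ reedMuller m r, 2 ^ (k + 1) ∣ bitWeight w f := by
  constructor
  · rintro ⟨-, h⟩ f hf
    have := congrArg (amplitude · f) (h _ (cosetState_mem_code hqr hrm hf))
    simp only [amplitude_tensorOp_zGatePow] at this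
    rwa [amplitude_cosetState_self, mul_one, zPhase_zpow_eq_one_iff] at this
  · intro h
    refine ⟨tensorOp_mem_cliffordHierarchy fun x => zGatePow_mem_monomialGates k _, ?_⟩
    intro ψ hψ
    refine ext_amplitude fun f => ?_
    rw [amplitude_tensorOp_zGatePow]
    by_cases hf : amplitude ψ f = 0
    · rw [hf, mul_zero]
    · rw [(zPhase_zpow_eq_one_iff k _).2 (h f (((mem_code_iff (hqr.trans hrm) ψ).1 hψ).2 f hf)),
        one_mul]

/-- The phase operator preserves the code if and only if the phases on its support are invariant
under the translations by the `X` generators. -/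
theorem preservesCode_tensorOp_iff (hqr : q ≤ r) (hrm : r ≤ m) :
    PreservesCode (code m q r) (tensorOp fun x => zGatePow k (w x)) ↔
      ∀ f ∈ reedMuller m r, ∀ (b : Cube m) (L : Finset (Fin m)), L.card = q →
        2 ^ (k + 1) ∣ bitWeight w (f + bitIndicator (face b L)) - bitWeight w f := by
  have hmem := mem_code_iff (m := m) (r := r) (hqr.trans hrm)
  constructor
  · intro h f hf b L hL
    have hψ := cosetState_mem_code hqr hrm hf
    have h1 := ((hmem _).1 (h _ hψ)).1 b L hL f
    rwa [amplitude_tensorOp_zGatePow, amplitude_tensorOp_zGatePow, ((hmem _).1 hψ).1 b L hL f,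
      amplitude_cosetState_self, mul_one, mul_one, zPhase_zpow_eq_iff] at h1
  · intro h ψ hψ
    obtain ⟨hX, hZ⟩ := (hmem ψ).1 hψ
    refine (hmem _).2 ⟨fun b L hL f => ?_, fun f hf => ?_⟩
    · rw [amplitude_tensorOp_zGatePow, amplitude_tensorOp_zGatePow, hX b L hL f]
      by_cases hf : amplitude ψ f = 0
      · rw [hf, mul_zero, mul_zero]
      · rw [(zPhase_zpow_eq_iff k _ _).2 (h f (hZ f hf) b L hL)]
    · rw [amplitude_tensorOp_zGatePow] at hf
      exact hZ f (right_ne_zero_of_mul hf)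

theorem tensorOp_mem_cliffordLogicals_iff :
    (tensorOp fun x => zGatePow k (w x)) ∈ cliffordLogicals (code m q r) k ↔
      PreservesCode (code m q r) (tensorOp fun x => zGatePow k (w x)) ∧
        (tensorOp fun x => zGatePow k (w x)) ∉ cliffordStabilizers (code m q r) k := by
  rw [cliffordLogicals, Set.mem_sdiff, tensorOp_mem_undetectableErrors_iff
    stabilizerGenerators_subset mem_code_iff_stabilizerGenerators
    fun x => zGatePow_mem_monomialGates k _]

end Phase

end QuantumRM

theorem mainTheorem1 (m q r k d : ℕ) (hqr : q ≤ r) (hrm : r ≤ m)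
    (A : Set (QuantumRM.Cube m)) (hA : QuantumRM.IsSubcube d A) :
    ((QuantumRM.signedZ k A ∈ QuantumRM.cliffordStabilizers (QuantumRM.code m q r) k ↔
          (k + 1) * r + 1 ≤ d) ∧
      (QuantumRM.signedZ k A ∈ QuantumRM.cliffordLogicals (QuantumRM.code m q r) k ↔
          q + k * r + 1 ≤ d ∧ d ≤ (k + 1) * r) ∧
      (QuantumRM.PreservesCode (QuantumRM.code m q r) (QuantumRM.signedZ k A) ↔
          q + k * r + 1 ≤ d)) ∧
    (0 < r →
      (QuantumRM.unsignedZ k A ∈ QuantumRM.cliffordStabilizers (QuantumRM.code m q r) k ↔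
          (k + 1) * r + 1 ≤ d) ∧
      (QuantumRM.unsignedZ k A ∈ QuantumRM.cliffordLogicals (QuantumRM.code m q r) k ↔
          q + k * r + 1 ≤ d ∧ d ≤ (k + 1) * r) ∧
      (QuantumRM.PreservesCode (QuantumRM.code m q r) (QuantumRM.unsignedZ k A) ↔
          q + k * r + 1 ≤ d)) := by
  obtain ⟨a, K, hK, rfl⟩ := QuantumRM.isSubcube_iff.1 hA
  have hcard : ∀ n, K.card + n ≤ m ↔ n ≤ d := fun n => by omega
  have hstab := QuantumRM.dvd_bitWeight_signed_iff k a K hrm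
  have hpres := QuantumRM.dvd_bitWeight_signed_sub_iff k a K hrm hqr
  rw [hcard] at hstab hpres
  rw [QuantumRM.signedZ_eq, QuantumRM.unsignedZ_eq, QuantumRM.tensorOp_mem_cliffordLogicals_iff,
    QuantumRM.tensorOp_mem_cliffordLogicals_iff, QuantumRM.preservesCode_tensorOp_iff k _ hqr hrm,
    QuantumRM.preservesCode_tensorOp_iff k _ hqr hrm,
    QuantumRM.tensorOp_mem_cliffordStabilizers_iff k _ hqr hrm,
    QuantumRM.tensorOp_mem_cliffordStabilizers_iff k _ hqr hrm]
  refine ⟨?_, fun hr => ?_⟩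
  · rw [hstab, hpres, Nat.not_le, Nat.lt_succ_iff]
    exact ⟨.rfl, .rfl, .rfl⟩
  · rw [QuantumRM.dvd_bitWeight_unsigned_iff k hr, QuantumRM.dvd_bitWeight_unsigned_sub_iff k hr,
      hstab, hpres, Nat.not_le, Nat.lt_succ_iff]
    exact ⟨.rfl, .rfl, .rfl⟩
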